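/- Let $G$ be a countable group acting by isometries on a Gromov hyperbolic metric space $S$ (not necessarily proper), i.e. there is $\delta\ge 0$ such that $(x,z)_t\ge\min\{(x,y)_t,(y,z)_t\}-\delta$ for all $x,y,z,t\in S$, where $(x,y)_t=\frac12(d(x,t)+d(y,t)-d(x,y))$. Let $\partial S$ be the Gromov boundary of $S$ (equivalence classes of sequences converging at infinity), with the induced action of $G$. For a subgroup $H\le G$ let $\Lambda(H)\subseteq\partial S$ be its limit set, i.e. the set of all limits in $\partial S$ of sequences of points of an $H$-orbit in $S$. Assume that the action of $G$ on $S$ is of general type: $\Lambda(G)$ is infinite and $G$ fixes no point of $\partial S$. Let $$E(G)=\{g\in G\mid g\xi=\xi\ \text{ for all }\xi\in\Lambda(G)\}$$ be the elliptic radical of $G$. Then $E(G)$ is the largest normal subgroup of $G$ that is elliptic, i.e. has bounded orbits in $S$. Moreover, let $\mu$ be an ergodic invariant random subgroup of $G$, that is, a Borel probability measure on the space $\mathrm{Sub}(G)$ of subgroups of $G$ (with the topology inherited from $\{0,1\}^G$) which is invariant under conjugation by $G$ and such that every conjugation-invariant Borel set has measure $0$ or $1$. Then at least one of the following holds: 1.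 $\mu$-almost every subgroup $H$ of $G$ is geometrically dense, i.e. $\Lambda(H)=\Lambda(G)$ and $H$ fixes no point of $\partial S$; 2. $\mu$-almost every subgroup $H$ of $G$ is contained in $E(G)$. -/

import Mathlib

open Filter MeasureTheory
open scoped Pointwise

/-! ### Hyperbolic spaces and the Gromov boundary -/

/-- The Gromov product `(x, y)_z`. -/
noncomputable def gromovProduct {S : Type*} [MetricSpace S] (z x y : S) : ℝ :=
  (dist x z + dist y z - dist x y) / 2

/-- Gromov hyperbolicity of an arbitrary (not necessarily geodesic or proper) metric space. -/
class GromovHyperbolic (S : Type*) [MetricSpace S] : Prop where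
  exists_delta : ∃ δ : ℝ, ∀ x y z t : S,
    min (gromovProduct t x y) (gromovProduct t y z) - δ ≤ gromovProduct t x z

/-- `γ`, restricted to `[0, dist x y]`, is a geodesic from `x` to `y`. -/
def IsGeodesicFromTo {S : Type*} [MetricSpace S] (γ : ℝ → S) (x y : S) : Prop :=
  γ 0 = x ∧ γ (dist x y) = y ∧
    ∀ a ∈ Set.Icc 0 (dist x y), ∀ b ∈ Set.Icc 0 (dist x y), dist (γ a) (γ b) = |a - b|

/-- Geodesic triangles are `δ`-slim: each side lies in the `δ`-neighbourhood of the union of the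
other two. -/
def SlimTriangles (S : Type*) [MetricSpace S] (δ : ℝ) : Prop :=
  ∀ (x y z : S) (γ α β : ℝ → S), IsGeodesicFromTo γ x y → IsGeodesicFromTo α x z →
    IsGeodesicFromTo β z y → ∀ a ∈ Set.Icc 0 (dist x y),
      (∃ b ∈ Set.Icc 0 (dist x z), dist (γ a) (α b) ≤ δ) ∨
      (∃ b ∈ Set.Icc 0 (dist z y), dist (γ a) (β b) ≤ δ)

theorem IsGeodesicFromTo.dist_add {S : Type*} [MetricSpace S] {γ : ℝ → S} {x y : S}
    (h : IsGeodesicFromTo γ x y) {a : ℝ} (ha : a ∈ Set.Icc 0 (dist x y)) :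
    dist x (γ a) + dist (γ a) y = dist x y := by
  obtain ⟨h0, h1, h2⟩ := h
  have e1 := h2 0 ⟨le_rfl, dist_nonneg⟩ a ha
  have e2 := h2 a ha (dist x y) ⟨dist_nonneg, le_rfl⟩
  rw [h0, zero_sub, abs_neg, abs_of_nonneg ha.1] at e1
  rw [h1, abs_of_nonpos (by linarith [ha.2])] at e2
  rw [e1, e2]
  ring

/-- Geodesic spaces with slim triangles are hyperbolic in the sense used here. -/
theorem GromovHyperbolic.of_slimTriangles {S : Type*} [MetricSpace S]
    (hgeo : ∀ x y : S, ∃ γ : ℝ → S, IsGeodesicFromTo γ x y) {δ : ℝ} (hδ : SlimTriangles S δ) :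
    GromovHyperbolic S := by
  refine ⟨⟨3 * δ + 2, fun x y z t => ?_⟩⟩
  obtain ⟨γ, hγ⟩ := hgeo x z
  obtain ⟨α, hα⟩ := hgeo x t
  obtain ⟨β, hβ⟩ := hgeo t z
  have key : ∃ p ∈ Set.Icc 0 (dist x z), dist t (γ p) ≤ gromovProduct t x z + 2 * δ + 2 := by
    have hs := hδ x z t γ α β hγ hα hβ
    have near : ∃ a ∈ Set.Icc 0 (dist x z), ∃ b ∈ Set.Icc 0 (dist x z), |a - b| ≤ 1 ∧
        (∃ u ∈ Set.Icc 0 (dist x t), dist (γ a) (α u) ≤ δ) ∧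
        (∃ u ∈ Set.Icc 0 (dist t z), dist (γ b) (β u) ≤ δ) := by
      have hδ0 : 0 ≤ δ := by
        rcases hs 0 ⟨le_rfl, dist_nonneg⟩ with ⟨u, -, hu⟩ | ⟨u, -, hu⟩ <;>
          exact dist_nonneg.trans hu
      set A : Set ℝ := {a | a ∈ Set.Icc 0 (dist x z) ∧
        ∃ u ∈ Set.Icc 0 (dist x t), dist (γ a) (α u) ≤ δ} with hA
      have h0A : (0 : ℝ) ∈ A := ⟨⟨le_rfl, dist_nonneg⟩, 0, ⟨le_rfl, dist_nonneg⟩, by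
        rw [hγ.1, hα.1, dist_self]; exact hδ0⟩
      have hbd : BddAbove A := ⟨dist x z, fun a ha => ha.1.2⟩
      obtain ⟨a, haA, ha⟩ := exists_lt_of_lt_csSup ⟨0, h0A⟩
        (show sSup A - 1 / 2 < sSup A by linarith)
      have hale : a ≤ sSup A := le_csSup hbd haA
      by_cases hL : dist x z ≤ sSup A + 1 / 2
      · refine ⟨a, haA.1, dist x z, ⟨dist_nonneg, le_rfl⟩, ?_, haA.2, dist t z,
          ⟨dist_nonneg, le_rfl⟩, ?_⟩
        · rw [abs_le]; constructor <;> linarith [haA.1.2]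
        · rw [hγ.2.1, hβ.2.1, dist_self]; exact hδ0
      · push Not at hL
        have hb : sSup A + 1 / 2 ∈ Set.Icc 0 (dist x z) := ⟨by linarith [haA.1.1], hL.le⟩
        refine ⟨a, haA.1, _, hb, ?_, haA.2, ?_⟩
        · rw [abs_le]; constructor <;> linarith
        · rcases hs _ hb with h | h
          · have := le_csSup hbd (show sSup A + 1 / 2 ∈ A from ⟨hb, h⟩)
            linarith
          · exact h
    obtain ⟨a, ha, b, hb, hab, ⟨u, hu, hu'⟩, v, hv, hv'⟩ := near
    refine ⟨a, ha, ?_⟩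
    have e1 := hα.dist_add hu
    have e2 := hβ.dist_add hv
    have e4 : dist (γ a) (γ b) ≤ 1 := (hγ.2.2 a ha b hb).trans_le hab
    have t1 := dist_triangle x (α u) (γ a)
    have t2 := dist_triangle (γ a) (α u) t
    have t3 := dist_triangle4 (γ a) (γ b) (β v) z
    have t4 := dist_triangle4 (γ a) (γ b) (β v) t
    have t5 := dist_triangle x (γ a) z
    have s1 := dist_comm (α u) (γ a)
    have s2 := dist_comm (β v) t
    have s3 := dist_comm t (γ a)
    have s4 := dist_comm z t
    unfold gromovProduct
    linarith
  obtain ⟨p, hp, hpt⟩ := key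
  have far : ∀ (x y q : S), dist x q + dist q y = dist x y → gromovProduct t x y ≤ dist t q := by
    intro x y q h
    have t1 := dist_triangle x q t
    have t2 := dist_triangle y q t
    have s1 := dist_comm y q
    have s2 := dist_comm t q
    unfold gromovProduct
    linarith
  obtain ⟨α', hα'⟩ := hgeo x y
  obtain ⟨β', hβ'⟩ := hgeo y z
  rcases hδ x z y γ α' β' hγ hα' hβ' p hp with ⟨u, hu, hu'⟩ | ⟨u, hu, hu'⟩
  · have h1 := far x y _ (hα'.dist_add hu)
    have h2 := dist_triangle t (γ p) (α' u)
    linarith [min_le_left (gromovProduct t x y) (gromovProduct t y z)]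
  · have h1 := far y z _ (hβ'.dist_add hu)
    have h2 := dist_triangle t (γ p) (β' u)
    linarith [min_le_right (gromovProduct t x y) (gromovProduct t y z)]

/-- `(x_i, y_j)_s → ∞` as `i, j → ∞` (for every base point `s`; the choice is immaterial). -/
def AsymptoticSeq {S : Type*} [MetricSpace S] (x y : ℕ → S) : Prop :=
  ∀ s : S, Tendsto (fun p : ℕ × ℕ => gromovProduct s (x p.1) (y p.2)) atTop atTop

/-- The sequence `x` converges at infinity: `(x_i, x_j)_s → ∞` as `i, j → ∞`. -/
def ConvergesAtInfinity {S : Type*} [MetricSpace S] (x : ℕ → S) : Prop :=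
  AsymptoticSeq x x

theorem AsymptoticSeq.symm {S : Type*} [MetricSpace S] {x y : ℕ → S}
    (h : AsymptoticSeq x y) : AsymptoticSeq y x := by
  intro s
  rw [tendsto_atTop_atTop]
  intro M
  obtain ⟨⟨i, j⟩, hij⟩ := tendsto_atTop_atTop.1 (h s) M
  refine ⟨(j, i), fun p hp => ?_⟩
  have := hij (p.2, p.1) ⟨hp.2, hp.1⟩
  have e : gromovProduct s (y p.1) (x p.2) = gromovProduct s (x p.2) (y p.1) := by
    unfold gromovProduct
    rw [dist_comm (y p.1) (x p.2)]
    ring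
  rw [e]
  exact this

theorem AsymptoticSeq.trans {S : Type*} [MetricSpace S] [GromovHyperbolic S] {x y z : ℕ → S}
    (hxy : AsymptoticSeq x y) (hyz : AsymptoticSeq y z) : AsymptoticSeq x z := by
  intro s
  obtain ⟨δ, hδ⟩ := GromovHyperbolic.exists_delta (S := S)
  rw [tendsto_atTop_atTop]
  intro M
  obtain ⟨⟨i, j⟩, hij⟩ := tendsto_atTop_atTop.1 (hxy s) (M + δ)
  obtain ⟨⟨k, l⟩, hkl⟩ := tendsto_atTop_atTop.1 (hyz s) (M + δ)
  refine ⟨(i, l), fun p hp => ?_⟩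
  have h1 := hij (p.1, max j k) ⟨hp.1, le_max_left _ _⟩
  have h2 := hkl (max j k, p.2) ⟨le_max_right _ _, hp.2⟩
  have h3 := hδ (x p.1) (y (max j k)) (z p.2) s
  have h4 := le_min h1 h2
  dsimp only at h4 ⊢
  linarith

/-- Equivalence of sequences converging at infinity. -/
def gromovSetoid (S : Type*) [MetricSpace S] [GromovHyperbolic S] :
    Setoid {x : ℕ → S // ConvergesAtInfinity x} where
  r x y := AsymptoticSeq x.1 y.1
  iseqv := ⟨fun x => x.2, fun h => h.symm, fun h h' => h.trans h'⟩

/-- The Gromov boundary `∂S`. -/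
def GromovBoundary (S : Type*) [MetricSpace S] [GromovHyperbolic S] : Type _ :=
  Quotient (gromovSetoid S)

/-- The sequence `x` of points of `S` converges to the boundary point `ξ`. -/
def ConvergesToBoundary {S : Type*} [MetricSpace S] [GromovHyperbolic S]
    (x : ℕ → S) (ξ : GromovBoundary S) : Prop :=
  ∃ hx : ConvergesAtInfinity x, Quotient.mk (gromovSetoid S) ⟨x, hx⟩ = ξ

/-! ### Isometric group actions -/

theorem AsymptoticSeq.smul {G S : Type*} [Group G] [MetricSpace S] [MulAction G S]
    [IsIsometricSMul G S] (g : G) {x y : ℕ → S} (h : AsymptoticSeq x y) :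
    AsymptoticSeq (fun n => g • x n) (fun n => g • y n) := by
  intro s
  have e : ∀ a : S, dist (g • a) s = dist a (g⁻¹ • s) := fun a => by
    rw [← dist_smul g a (g⁻¹ • s), smul_inv_smul]
  simpa only [gromovProduct, e, dist_smul] using h (g⁻¹ • s)

/-- The action of `G` on `∂S` induced by `g • (x_n) = (g • x_n)`. -/
instance GromovBoundary.instMulAction {G S : Type*} [Group G] [MetricSpace S]
    [GromovHyperbolic S] [MulAction G S] [IsIsometricSMul G S] :
    MulAction G (GromovBoundary S) where
  smul g := Quotient.map (sa := gromovSetoid S) (sb := gromovSetoid S)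
    (fun x => ⟨fun n => g • x.1 n, AsymptoticSeq.smul g x.2⟩)
    (fun _ _ h => AsymptoticSeq.smul g h)
  one_smul ξ := by
    induction ξ using Quotient.inductionOn with
    | _ x =>
      exact congrArg (Quotient.mk (gromovSetoid S))
        (Subtype.ext (funext fun n => one_smul G (x.1 n)))
  mul_smul g h ξ := by
    induction ξ using Quotient.inductionOn with
    | _ x =>
      exact congrArg (Quotient.mk (gromovSetoid S))
        (Subtype.ext (funext fun n => mul_smul g h (x.1 n)))

section Actions

variable {G : Type*} (S : Type*) [Group G] [MetricSpace S] [MulAction G S] [IsIsometricSMul G S]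

/-- The limit set `Λ(H) ⊆ ∂S`: all boundary points to which some sequence of points of an
`H`-orbit in `S` converges. -/
def limitSet [GromovHyperbolic S] (H : Subgroup G) : Set (GromovBoundary S) :=
  {ξ | ∃ (s : S) (h : ℕ → G), (∀ n, h n ∈ H) ∧ ConvergesToBoundary (fun n => h n • s) ξ}

/-- `H` fixes no point of `∂S`. -/
def FixesNoBoundaryPoint [GromovHyperbolic S] (H : Subgroup G) : Prop :=
  ∀ ξ : GromovBoundary S, ∃ h ∈ H, h • ξ ≠ ξ

variable (G) in
/-- The action of `G` on `S` is of general type: the limit set `Λ(G)` is infinite and `G` fixes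
no point of `∂S`. -/
def IsGeneralType [GromovHyperbolic S] : Prop :=
  (limitSet S (⊤ : Subgroup G)).Infinite ∧ FixesNoBoundaryPoint S (⊤ : Subgroup G)

/-- `H` is geometrically dense in `G`. -/
def IsGeometricallyDense [GromovHyperbolic S] (H : Subgroup G) : Prop :=
  limitSet S H = limitSet S (⊤ : Subgroup G) ∧ FixesNoBoundaryPoint S H

/-- `H` is elliptic: its orbits in `S` are bounded. -/
def IsElliptic (H : Subgroup G) : Prop :=
  ∀ s : S, Bornology.IsBounded {p : S | ∃ h ∈ H, p = h • s}

variable (G) in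
/-- The elliptic radical `E(G)`: all `g ∈ G` that fix `Λ(G)` pointwise. -/
def ellipticRadical [GromovHyperbolic S] : Subgroup G :=
  fixingSubgroup G (limitSet S (⊤ : Subgroup G))

end Actions

/-! ### Invariant random subgroups -/

open Classical in
/-- The topology on the space of subgroups of `G` inherited from the product `{0,1}^G`. -/
noncomputable instance Subgroup.instTopologicalSpaceSub {G : Type*} [Group G] :
    TopologicalSpace (Subgroup G) :=
  TopologicalSpace.induced (fun (H : Subgroup G) (g : G) => decide (g ∈ H)) Pi.topologicalSpace

noncomputable instance Subgroup.instMeasurableSpaceSub {G : Type*} [Group G] : MeasurableSpace (Subgroup G) :=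
  borel (Subgroup G)

/-- An invariant random subgroup of `G`: a conjugation-invariant Borel probability measure on the
space of subgroups (`MulAut.conj g • H = g H g⁻¹`). -/
structure IsIRS {G : Type*} [Group G] (μ : Measure (Subgroup G)) : Prop where
  isProbabilityMeasure : IsProbabilityMeasure μ
  invariant : ∀ (g : G) (A : Set (Subgroup G)), MeasurableSet A →
    μ ((fun H => MulAut.conj g • H) ⁻¹' A) = μ A

/-- An ergodic invariant random subgroup: conjugation-invariant Borel sets have measure `0`
or `1`. -/
structure IsErgodicIRS {G : Type*} [Group G] (μ : Measure (Subgroup G)) : Prop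
    extends IsIRS μ where
  ergodic : ∀ A : Set (Subgroup G), MeasurableSet A →
    (∀ g : G, (fun H => MulAut.conj g • H) ⁻¹' A = A) → μ A = 0 ∨ μ A = 1

/-! ### Elementary properties of the Gromov product -/

section GromovProduct

variable {S : Type*} [MetricSpace S]

/-! A group fixing three boundary points has bounded orbits, since every translate of a base point
is a coarse centre of the same triple; hence `ellipticRadical` is elliptic. Conversely, if `N` is
normal and elliptic, then `n ∈ N` moves the points `g k • s` by a uniformly bounded amount and so
fixes their limits.

For the dichotomy, ergodicity makes ellipticity an almost sure alternative. The engine is recurrence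
(`IsIRS.measure_iUnion_le`): what conjugation by `g n` forces on a random subgroup holds, with at
least the same probability, for the subgroup itself at infinitely many `n`.

If `H` is elliptic and contains `h` with positive probability, recurrence makes `h` move infinitely
many `g n • s` boundedly, so `h` fixes their limit.

If `H` is not elliptic, a given boundary point is almost surely not fixed: its `G`-orbit is
infinite, and recurrence would make `H` fix three of its points. For `g n • s → ξ`, some `p ∈ H`
moves the directions of `(g n)⁻¹ • s` away from themselves, so `g n * p * (g n)⁻¹` sends `s` towards
`ξ`; recurrence gives `ξ ∈ Λ(H)`. If instead `H` fixed some `ζ`, its conjugates would fix the points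
`g n • ζ`, which approach `ξ`, and recurrence would make `H` fix `ξ`, which is already excluded. -/

theorem gromovProduct_comm (t x y : S) : gromovProduct t x y = gromovProduct t y x := by
  unfold gromovProduct
  rw [dist_comm x y]
  ring

theorem gromovProduct_self (t x : S) : gromovProduct t x x = dist x t := by
  unfold gromovProduct
  rw [dist_self]
  ring

theorem gromovProduct_le_add_dist_base (t t' x y : S) :
    gromovProduct t x y ≤ gromovProduct t' x y + dist t t' := by
  unfold gromovProduct
  linarith [dist_triangle x t' t, dist_triangle y t' t, dist_comm t t']

theorem gromovProduct_le_add_dist_right (t x y y' : S) :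
    gromovProduct t x y ≤ gromovProduct t x y' + dist y y' := by
  unfold gromovProduct
  linarith [dist_triangle y y' t, dist_triangle x y y']

theorem gromovProduct_add_gromovProduct (t x y : S) :
    gromovProduct t x y + gromovProduct x t y = dist x t := by
  unfold gromovProduct
  linarith [dist_comm t x, dist_comm y t, dist_comm y x]

theorem gromovProduct_smul {G : Type*} [Group G] [MulAction G S] [IsIsometricSMul G S]
    (g : G) (t x y : S) : gromovProduct (g • t) (g • x) (g • y) = gromovProduct t x y := by
  simp only [gromovProduct, dist_smul]

theorem gromovProduct_smul_base {G : Type*} [Group G] [MulAction G S] [IsIsometricSMul G S]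
    (g : G) (t x y : S) :
    gromovProduct (g • t) x y = gromovProduct t (g⁻¹ • x) (g⁻¹ • y) := by
  rw [← gromovProduct_smul g t, smul_inv_smul, smul_inv_smul]

variable (S) in
/-- The four-point inequality with constant `δ`. -/
def IsHyperbolicWith (δ : ℝ) : Prop :=
  ∀ x y z t : S, min (gromovProduct t x y) (gromovProduct t y z) - δ ≤ gromovProduct t x z

variable (S) in
theorem exists_isHyperbolicWith [GromovHyperbolic S] : ∃ δ : ℝ, 0 ≤ δ ∧ IsHyperbolicWith S δ := by
  obtain ⟨δ, hδ⟩ := GromovHyperbolic.exists_delta (S := S)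
  refine ⟨max δ 0, le_max_right _ _, fun x y z t => ?_⟩
  linarith [hδ x y z t, le_max_left δ 0]

theorem IsHyperbolicWith.le_trans {δ : ℝ} (hδ : IsHyperbolicWith S δ) {t x y z : S} {a : ℝ}
    (h₁ : a ≤ gromovProduct t x y) (h₂ : a ≤ gromovProduct t y z) :
    a - δ ≤ gromovProduct t x z := by
  linarith [hδ x y z t, le_min h₁ h₂]

theorem IsHyperbolicWith.le_or_le {δ : ℝ} (hδ : IsHyperbolicWith S δ) {t x z : S} {a : ℝ} (y : S)
    (h : gromovProduct t x z ≤ a) :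
    gromovProduct t x y ≤ a + δ ∨ gromovProduct t y z ≤ a + δ := by
  rw [← min_le_iff]
  linarith [hδ x y z t]

/-- Coarse uniqueness of the centre of a triple of points. -/
theorem IsHyperbolicWith.dist_le_of_center {δ : ℝ} (hδ : IsHyperbolicWith S δ)
    {s t a b c : S} {C : ℝ}
    (sab : gromovProduct s a b ≤ C) (sac : gromovProduct s a c ≤ C)
    (sbc : gromovProduct s b c ≤ C) (tab : gromovProduct t a b ≤ C)
    (tac : gromovProduct t a c ≤ C) (tbc : gromovProduct t b c ≤ C) :
    dist s t ≤ 2 * (C + δ) := by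
  have key : ∀ x : S, gromovProduct s x t ≤ C + δ → gromovProduct t x s ≤ C + δ →
      dist s t ≤ 2 * (C + δ) := fun x h₁ h₂ => by
    have := gromovProduct_add_gromovProduct s t x
    rw [gromovProduct_comm s x t] at h₁
    rw [gromovProduct_comm t x s] at h₂
    rw [dist_comm]
    linarith
  -- From `s`, at most one of `a`, `b`, `c` lies in the direction of `t`, and likewise with `s` and
  -- `t` exchanged. So one of the three is good for both, and `key` applies to it.
  have e := gromovProduct_comm (S := S)
  have h₁ := hδ.le_or_le t sab
  have h₂ := hδ.le_or_le t sac
  have h₃ := hδ.le_or_le t sbc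
  have h₄ := hδ.le_or_le s tab
  have h₅ := hδ.le_or_le s tac
  have h₆ := hδ.le_or_le s tbc
  rw [e s t b] at h₁
  rw [e s t c] at h₂ h₃
  rw [e t s b] at h₄
  rw [e t s c] at h₅ h₆
  have ka := key a
  have kb := key b
  have kc := key c
  tauto

/-- An isometry that coarsely fixes the directions of three points seen from `s` in different
directions moves `s` by a bounded amount. -/
theorem IsHyperbolicWith.dist_smul_le_of_three {G : Type*} [Group G] [MulAction G S]
    [IsIsometricSMul G S] {δ : ℝ} (hδ0 : 0 ≤ δ) (hδ : IsHyperbolicWith S δ) {s a b c : S} {C : ℝ}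
    (sab : gromovProduct s a b ≤ C) (sac : gromovProduct s a c ≤ C)
    (sbc : gromovProduct s b c ≤ C) (g : G)
    (ha : C + 2 * δ < gromovProduct s a (g • a)) (hb : C + 2 * δ < gromovProduct s b (g • b))
    (hc : C + 2 * δ < gromovProduct s c (g • c)) :
    dist (g • s) s ≤ 2 * (C + 3 * δ) := by
  have move : ∀ x y : S, gromovProduct s x y ≤ C → C + 2 * δ < gromovProduct s x (g • x) →
      C + 2 * δ < gromovProduct s y (g • y) →
      gromovProduct (g⁻¹ • s) x y ≤ C + 2 * δ := fun x y hxy hx hy => by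
    rw [gromovProduct_smul_base, inv_inv]
    rcases hδ.le_or_le (g • x) hxy with h | h
    · linarith
    rcases hδ.le_or_le (g • y) h with h | h
    · linarith
    · rw [gromovProduct_comm] at h
      linarith
  have h := hδ.dist_le_of_center (C := C + 2 * δ) (by linarith) (by linarith) (by linarith)
    (move a b sab ha hb) (move a c sac ha hc) (move b c sbc hb hc)
  rw [← dist_smul g, smul_inv_smul] at h
  linarith

end GromovProduct

/-! ### Sequences converging at infinity -/

section Sequences

variable {S : Type*} [MetricSpace S]

theorem asymptoticSeq_iff (s : S) {x y : ℕ → S} :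
    AsymptoticSeq x y ↔ ∀ M : ℝ, ∃ N, ∀ i ≥ N, ∀ j ≥ N, M ≤ gromovProduct s (x i) (y j) := by
  constructor
  · intro h M
    obtain ⟨⟨i, j⟩, hij⟩ := tendsto_atTop_atTop.1 (h s) M
    exact ⟨max i j, fun k hk l hl => hij (k, l)
      ⟨(le_max_left _ _).trans hk, (le_max_right _ _).trans hl⟩⟩
  · intro h t
    rw [tendsto_atTop_atTop]
    intro M
    obtain ⟨N, hN⟩ := h (M + dist s t)
    refine ⟨(N, N), fun p hp => ?_⟩
    have := hN p.1 hp.1 p.2 hp.2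
    linarith [gromovProduct_le_add_dist_base s t (x p.1) (y p.2)]

theorem ConvergesAtInfinity.tendsto_dist {x : ℕ → S} (hx : ConvergesAtInfinity x) (s : S) :
    Tendsto (fun n => dist (x n) s) atTop atTop := by
  rw [tendsto_atTop_atTop]
  intro M
  obtain ⟨N, hN⟩ := (asymptoticSeq_iff s).1 hx M
  exact ⟨N, fun n hn => by simpa [gromovProduct_self] using hN n hn n hn⟩

theorem ConvergesAtInfinity.asymptoticSeq_comp {x : ℕ → S} (hx : ConvergesAtInfinity x)
    {φ : ℕ → ℕ} (hφ : Tendsto φ atTop atTop) : AsymptoticSeq x (x ∘ φ) := by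
  rw [asymptoticSeq_iff (x 0)]
  intro M
  obtain ⟨N, hN⟩ := (asymptoticSeq_iff (x 0)).1 hx M
  obtain ⟨N', hN'⟩ := tendsto_atTop_atTop.1 hφ N
  exact ⟨max N N', fun i hi j hj => hN i ((le_max_left _ _).trans hi) _
    (hN' j ((le_max_right _ _).trans hj))⟩

variable [GromovHyperbolic S]

theorem ConvergesAtInfinity.asymptoticSeq_of_le {x y : ℕ → S} (hx : ConvergesAtInfinity x) (s : S)
    (h : ∀ M : ℝ, ∀ᶠ n in atTop, M ≤ gromovProduct s (x n) (y n)) : AsymptoticSeq x y := by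
  obtain ⟨δ, -, hδ⟩ := exists_isHyperbolicWith S
  rw [asymptoticSeq_iff s]
  intro M
  obtain ⟨N, hN⟩ := (asymptoticSeq_iff s).1 hx (M + δ)
  obtain ⟨N', hN'⟩ := eventually_atTop.1 (h (M + δ))
  refine ⟨max N N', fun i hi j hj => ?_⟩
  have := hδ.le_trans (hN i ((le_max_left _ _).trans hi) j ((le_max_left _ _).trans hj))
    (hN' j ((le_max_right _ _).trans hj))
  linarith

/-- A sequence has a subsequence that converges at infinity, or one whose terms are seen from `s`
in pairwise different directions. -/
theorem exists_subseq_converges_or_separated (s : S) (y : ℕ → S) :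
    (∃ φ : ℕ → ℕ, StrictMono φ ∧ ConvergesAtInfinity (y ∘ φ)) ∨
      ∃ (C : ℝ) (φ : ℕ → ℕ), StrictMono φ ∧
        ∀ i j, i ≠ j → gromovProduct s (y (φ i)) (y (φ j)) ≤ C := by
  obtain ⟨δ, -, hδ⟩ := exists_isHyperbolicWith S
  -- The hyperfilter decides, for each `i` and `C`, whether most `y j` are close to `y i`. If
  -- centres `c m` exist at every level, a diagonal subsequence converges; otherwise separated terms
  -- are picked greedily.
  have hU : (hyperfilter ℕ : Filter ℕ) ≤ atTop := Nat.hyperfilter_le_atTop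
  by_cases h : ∀ C : ℝ, ∃ i, ∀ᶠ j in hyperfilter ℕ, C < gromovProduct s (y i) (y j)
  · left
    choose c hc using h
    obtain ⟨φ, hφ, hφ'⟩ := extraction_forall_of_frequently
      (P := fun n k => ∀ m ∈ Set.Iic n, (m : ℝ) < gromovProduct s (y (c m)) (y k)) fun n =>
        (((Set.finite_Iic n).eventually_all (l := (hyperfilter ℕ : Filter ℕ))).2
          fun m _ => hc m).frequently.filter_mono hU
    refine ⟨φ, hφ, (asymptoticSeq_iff s).2 fun M => ?_⟩
    obtain ⟨N, hN⟩ := exists_nat_ge (M + δ)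
    refine ⟨N, fun i hi j hj => ?_⟩
    have h₁ := hφ' i N hi
    rw [gromovProduct_comm] at h₁
    have := hδ.le_trans h₁.le (hφ' j N hj).le
    simp only [Function.comp]
    linarith
  · right
    push Not at h
    obtain ⟨C, hC⟩ := h
    obtain ⟨φ, -, hφ⟩ := exists_seq_of_forall_finset_exists (fun _ : ℕ => True)
      (fun i j => i < j ∧ gromovProduct s (y i) (y j) ≤ C) fun F _ => by
        have : ∀ᶠ j in (hyperfilter ℕ : Filter ℕ),
            ∀ i ∈ F, i < j ∧ gromovProduct s (y i) (y j) ≤ C := by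
          refine (Finset.eventually_all F).2 fun i _ =>
            ((eventually_gt_atTop i).filter_mono hU).and ?_
          simpa [Ultrafilter.frequently_iff_eventually] using hC i
        obtain ⟨j, hj⟩ := this.exists
        exact ⟨j, trivial, hj⟩
    refine ⟨C, φ, strictMono_nat_of_lt_succ fun n => (hφ n (n + 1) n.lt_succ_self).1,
      fun i j hij => ?_⟩
    rcases hij.lt_or_gt with h | h
    · exact (hφ i j h).2
    · rw [gromovProduct_comm]
      exact (hφ j i h).2

end Sequences

/-! ### Boundary points -/

section Boundary

variable {S : Type*} [MetricSpace S] [GromovHyperbolic S]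

theorem GromovBoundary.exists_converges (ξ : GromovBoundary S) :
    ∃ x : ℕ → S, ConvergesToBoundary x ξ := by
  induction ξ using Quotient.inductionOn with
  | _ x => exact ⟨x.1, x.2, rfl⟩

theorem ConvergesToBoundary.asymptoticSeq {x y : ℕ → S} {ξ : GromovBoundary S}
    (hx : ConvergesToBoundary x ξ) (hy : ConvergesToBoundary y ξ) : AsymptoticSeq x y := by
  obtain ⟨hx, rfl⟩ := hx
  obtain ⟨hy, h⟩ := hy
  exact (Quotient.exact (s := gromovSetoid S) h).symm

theorem ConvergesToBoundary.of_asymptoticSeq {x y : ℕ → S} {ξ : GromovBoundary S}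
    (hx : ConvergesToBoundary x ξ) (h : AsymptoticSeq x y) : ConvergesToBoundary y ξ := by
  obtain ⟨hx, rfl⟩ := hx
  exact ⟨h.symm.trans h, Quotient.sound (s := gromovSetoid S) h.symm⟩

theorem ConvergesToBoundary.eq_of_asymptoticSeq {x y : ℕ → S} {ξ η : GromovBoundary S}
    (hx : ConvergesToBoundary x ξ) (hy : ConvergesToBoundary y η) (h : AsymptoticSeq x y) :
    ξ = η := by
  obtain ⟨hx, rfl⟩ := hx
  obtain ⟨hy, rfl⟩ := hy
  exact Quotient.sound (s := gromovSetoid S) h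

theorem ConvergesToBoundary.comp {x : ℕ → S} {ξ : GromovBoundary S}
    (hx : ConvergesToBoundary x ξ) {φ : ℕ → ℕ} (hφ : Tendsto φ atTop atTop) :
    ConvergesToBoundary (x ∘ φ) ξ :=
  hx.of_asymptoticSeq (hx.1.asymptoticSeq_comp hφ)

theorem ConvergesToBoundary.of_le {x y : ℕ → S} {ξ : GromovBoundary S}
    (hx : ConvergesToBoundary x ξ) (s : S)
    (h : ∀ M : ℝ, ∀ᶠ n in atTop, M ≤ gromovProduct s (x n) (y n)) : ConvergesToBoundary y ξ :=
  hx.of_asymptoticSeq (hx.1.asymptoticSeq_of_le s h)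

theorem ConvergesToBoundary.of_dist_le {x y : ℕ → S} {ξ : GromovBoundary S}
    (hx : ConvergesToBoundary x ξ) {C : ℝ} (h : ∀ n, dist (x n) (y n) ≤ C) :
    ConvergesToBoundary y ξ := by
  refine hx.of_le (x 0) fun M => ?_
  filter_upwards [(hx.1.tendsto_dist (x 0)).eventually_ge_atTop (M + C)] with n hn
  have := gromovProduct_le_add_dist_right (x 0) (x n) (x n) (y n)
  rw [gromovProduct_self] at this
  linarith [h n]

/-- The Gromov product at `s` of the boundary points `ξ` and `η` is at most `C`, along all
sequences representing them. -/
def BoundaryProductLE (s : S) (C : ℝ) (ξ η : GromovBoundary S) : Prop :=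
  ∀ x y : ℕ → S, ConvergesToBoundary x ξ → ConvergesToBoundary y η →
    ∃ N, ∀ i ≥ N, ∀ j ≥ N, gromovProduct s (x i) (y j) ≤ C

theorem BoundaryProductLE.mono {s : S} {C D : ℝ} {ξ η : GromovBoundary S}
    (h : BoundaryProductLE s C ξ η) (hCD : C ≤ D) : BoundaryProductLE s D ξ η :=
  fun x y hx hy => (h x y hx hy).imp fun _ hN i hi j hj => (hN i hi j hj).trans hCD

/-- Changing both representing sequences costs only `2 * δ`, so products unbounded over all
representatives would make fixed representatives asymptotic. -/
theorem exists_boundaryProductLE (s : S) {ξ η : GromovBoundary S} (h : ξ ≠ η) :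
    ∃ C, BoundaryProductLE s C ξ η := by
  obtain ⟨δ, hδ0, hδ⟩ := exists_isHyperbolicWith S
  by_contra! hcon
  obtain ⟨x, hx⟩ := ξ.exists_converges
  obtain ⟨y, hy⟩ := η.exists_converges
  refine h (hx.eq_of_asymptoticSeq hy ((asymptoticSeq_iff s).2 fun M => ?_))
  have hM := hcon (M + 2 * δ)
  simp only [BoundaryProductLE, not_forall, not_exists, not_le] at hM
  obtain ⟨x', y', hx', hy', hxy⟩ := hM
  obtain ⟨N₁, h₁⟩ := (asymptoticSeq_iff s).1 (hx.asymptoticSeq hx') (M + 2 * δ)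
  obtain ⟨N₂, h₂⟩ := (asymptoticSeq_iff s).1 (hy'.asymptoticSeq hy) (M + 2 * δ)
  obtain ⟨k, hk, l, hl, hkl⟩ := hxy (max N₁ N₂)
  refine ⟨max N₁ N₂, fun i hi j hj => ?_⟩
  rw [ge_iff_le, max_le_iff] at hi hj hk hl
  have e := hδ.le_trans (h₁ i hi.1 k hk.1) hkl.le
  have e' := hδ.le_trans e (by linarith [h₂ l hl.2 j hj.2] : _ ≤ gromovProduct s (y' l) (y j))
  linarith

theorem ConvergesToBoundary.eq_of_frequently {x y : ℕ → S} {ξ η : GromovBoundary S}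
    (hx : ConvergesToBoundary x ξ) (hy : ConvergesToBoundary y η) (s : S)
    (h : ∀ M : ℝ, ∃ᶠ n in atTop, M ≤ gromovProduct s (x n) (y n)) : ξ = η := by
  by_contra hne
  obtain ⟨C, hC⟩ := exists_boundaryProductLE s hne
  obtain ⟨N, hN⟩ := hC x y hx hy
  obtain ⟨n, hn, hn'⟩ := frequently_atTop.1 (h (C + 1)) N
  linarith [hN n hn n hn]

end Boundary

/-! ### Isometric actions on the boundary -/

section BoundaryAction

theorem isElliptic_iff {G S : Type*} [Group G] [MetricSpace S] [MulAction G S]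
    [IsIsometricSMul G S] (s : S) {H : Subgroup G} :
    IsElliptic S H ↔ ∃ C : ℝ, ∀ h ∈ H, dist (h • s) s ≤ C := by
  constructor
  · intro h
    obtain ⟨C, hC⟩ := Metric.isBounded_iff.1 (h s)
    exact ⟨C, fun g hg => hC ⟨g, hg, rfl⟩ ⟨1, H.one_mem, (one_smul G s).symm⟩⟩
  · rintro ⟨C, hC⟩ t
    refine (Metric.isBounded_iff_subset_closedBall s).2 ⟨C + dist t s, ?_⟩
    rintro _ ⟨h, hh, rfl⟩
    rw [Metric.mem_closedBall]
    have := dist_triangle (h • t) (h • s) s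
    rw [dist_smul] at this
    linarith [hC h hh]

theorem limitSet_mono {G S : Type*} [Group G] [MetricSpace S] [GromovHyperbolic S]
    [MulAction G S] {H K : Subgroup G} (h : H ≤ K) : limitSet S H ⊆ limitSet S K := by
  rintro ξ ⟨s, u, hu, hξ⟩
  exact ⟨s, u, fun n => h (hu n), hξ⟩

variable {G S : Type*} [Group G] [MetricSpace S] [GromovHyperbolic S] [MulAction G S]
  [IsIsometricSMul G S]

theorem ConvergesToBoundary.smul (g : G) {x : ℕ → S} {ξ : GromovBoundary S}
    (hx : ConvergesToBoundary x ξ) : ConvergesToBoundary (fun n => g • x n) (g • ξ) := by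
  obtain ⟨hx, rfl⟩ := hx
  exact ⟨AsymptoticSeq.smul g hx, rfl⟩

theorem BoundaryProductLE.smul (g : G) {s : S} {C : ℝ} {ξ η : GromovBoundary S}
    (h : BoundaryProductLE s C ξ η) : BoundaryProductLE (g • s) C (g • ξ) (g • η) := by
  intro x y hx hy
  have hx' := hx.smul g⁻¹
  have hy' := hy.smul g⁻¹
  rw [inv_smul_smul] at hx' hy'
  simpa only [gromovProduct_smul_base] using h _ _ hx' hy'

/-- A group fixing three boundary points has bounded orbits. -/
theorem isElliptic_of_fixes_three {H : Subgroup G} {a b c : GromovBoundary S} (hab : a ≠ b)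
    (hac : a ≠ c) (hbc : b ≠ c) (ha : ∀ h ∈ H, h • a = a) (hb : ∀ h ∈ H, h • b = b)
    (hc : ∀ h ∈ H, h • c = c) : IsElliptic S H := by
  obtain ⟨δ, -, hδ⟩ := exists_isHyperbolicWith S
  obtain ⟨x, hx⟩ := a.exists_converges
  obtain ⟨y, hy⟩ := b.exists_converges
  obtain ⟨z, hz⟩ := c.exists_converges
  set s := x 0
  obtain ⟨C₁, h₁⟩ := exists_boundaryProductLE s hab
  obtain ⟨C₂, h₂⟩ := exists_boundaryProductLE s hac
  obtain ⟨C₃, h₃⟩ := exists_boundaryProductLE s hbc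
  set C := max C₁ (max C₂ C₃)
  replace h₁ := h₁.mono (D := C) (le_max_left _ _)
  replace h₂ := h₂.mono (D := C) ((le_max_left _ _).trans (le_max_right _ _))
  replace h₃ := h₃.mono (D := C) ((le_max_right _ _).trans (le_max_right _ _))
  refine (isElliptic_iff s).2 ⟨2 * (C + δ), fun h hh => ?_⟩
  -- As `h` fixes the triple, both `s` and `h • s` see its three points in different directions.
  have h₁' := h₁.smul h
  have h₂' := h₂.smul h
  have h₃' := h₃.smul h
  rw [ha h hh, hb h hh] at h₁'
  rw [ha h hh, hc h hh] at h₂'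
  rw [hb h hh, hc h hh] at h₃'
  have ev : ∀ {t : S} {p q : GromovBoundary S} {u v : ℕ → S}, BoundaryProductLE t C p q →
      ConvergesToBoundary u p → ConvergesToBoundary v q →
      ∀ᶠ n in atTop, gromovProduct t (u n) (v n) ≤ C := fun h hu hv => by
    obtain ⟨N, hN⟩ := h _ _ hu hv
    filter_upwards [eventually_ge_atTop N] with n hn using hN n hn n hn
  obtain ⟨n, e₁, e₂, e₃, e₄, e₅, e₆⟩ := ((ev h₁' hx hy).and <| (ev h₂' hx hz).and <|
    (ev h₃' hy hz).and <| (ev h₁ hx hy).and <| (ev h₂ hx hz).and (ev h₃ hy hz)).exists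
  exact hδ.dist_le_of_center e₁ e₂ e₃ e₄ e₅ e₆

theorem mem_limitSet_iff (s : S) {H : Subgroup G} {ξ : GromovBoundary S} :
    ξ ∈ limitSet S H ↔
      ∃ h : ℕ → G, (∀ n, h n ∈ H) ∧ ConvergesToBoundary (fun n => h n • s) ξ := by
  constructor
  · rintro ⟨t, h, hH, hξ⟩
    exact ⟨h, hH, hξ.of_dist_le fun n => (dist_smul (h n) t s).le⟩
  · rintro ⟨h, hH, hξ⟩
    exact ⟨s, h, hH, hξ⟩

theorem smul_mem_limitSet_top (g : G) {ξ : GromovBoundary S}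
    (hξ : ξ ∈ limitSet S (⊤ : Subgroup G)) : g • ξ ∈ limitSet S (⊤ : Subgroup G) := by
  obtain ⟨s, h, -, hξ⟩ := hξ
  exact ⟨s, fun n => g * h n, fun _ => trivial, by simpa only [mul_smul] using hξ.smul g⟩

theorem mem_ellipticRadical_iff {g : G} :
    g ∈ ellipticRadical G S ↔ ∀ ξ ∈ limitSet S (⊤ : Subgroup G), g • ξ = ξ :=
  mem_fixingSubgroup_iff G

/-- An element that moves `x n` by a bounded amount along a subsequence fixes the limit. -/
theorem ConvergesToBoundary.smul_eq_of_frequently_dist_le {x : ℕ → S} {ξ : GromovBoundary S}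
    (hx : ConvergesToBoundary x ξ) (g : G) {C : ℝ}
    (h : ∃ᶠ n in atTop, dist (x n) (g • x n) ≤ C) : g • ξ = ξ := by
  refine (hx.eq_of_frequently (hx.smul g) (x 0) fun M => ?_).symm
  refine (h.and_eventually
    ((hx.1.tendsto_dist (x 0)).eventually_ge_atTop (M + C))).mono fun n hn => ?_
  have := gromovProduct_le_add_dist_right (x 0) (x n) (x n) (g • x n)
  rw [gromovProduct_self] at this
  linarith [hn.1, hn.2]

theorem isGreatest_ellipticRadical (hG : IsGeneralType G S) :
    IsGreatest {N : Subgroup G | N.Normal ∧ IsElliptic S N} (ellipticRadical G S) := by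
  refine ⟨⟨⟨fun n hn g => ?_⟩, ?_⟩, ?_⟩
  · rw [mem_ellipticRadical_iff] at hn ⊢
    intro ξ hξ
    rw [mul_smul, mul_smul, hn _ (smul_mem_limitSet_top g⁻¹ hξ), smul_inv_smul]
  · classical
    obtain ⟨F, hF, hF3⟩ := hG.1.exists_subset_card_eq 3
    obtain ⟨a, b, c, hab, hac, hbc, rfl⟩ := Finset.card_eq_three.1 hF3
    simp only [Finset.coe_insert, Finset.coe_singleton, Set.insert_subset_iff,
      Set.singleton_subset_iff] at hF
    exact isElliptic_of_fixes_three hab hac hbc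
      (fun h hh => mem_ellipticRadical_iff.1 hh a hF.1)
      (fun h hh => mem_ellipticRadical_iff.1 hh b hF.2.1)
      (fun h hh => mem_ellipticRadical_iff.1 hh c hF.2.2)
  · rintro N ⟨hN, hell⟩ n hn
    rw [mem_ellipticRadical_iff]
    rintro ξ ⟨s, g, -, hξ⟩
    obtain ⟨C, hC⟩ := (isElliptic_iff s).1 hell
    refine hξ.smul_eq_of_frequently_dist_le (C := C) n (Frequently.of_forall fun k => ?_)
    -- The displacement of `g k • s` under `n` is that of `s` under a conjugate of `n`, which lies
    -- in `N`.
    rw [dist_comm, ← dist_smul (g k)⁻¹, inv_smul_smul, smul_smul, smul_smul]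
    simpa using hC _ (hN.conj_mem n hn (g k)⁻¹)

/-- For an action of general type, orbits in the boundary are infinite. -/
theorem IsGeneralType.infinite_orbit (hG : IsGeneralType G S) (η : GromovBoundary S) :
    (MulAction.orbit G η).Infinite := by
  intro hfin
  obtain ⟨δ, -, hδ⟩ := exists_isHyperbolicWith S
  obtain ⟨k, -, hk⟩ := hG.2 η
  obtain ⟨ξ, hξ, hξF⟩ := (hG.1.sdiff hfin).nonempty
  have hξη : ξ ≠ η := fun h => hξF (by rw [h]; exact MulAction.mem_orbit_self η)
  have hξη' : ξ ≠ k • η := fun h => hξF (by rw [h]; exact MulAction.mem_orbit η k)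
  obtain ⟨s, g, -, hg⟩ := hξ
  -- Finiteness of the orbit gives one bound for all pairs of distinct points. By equivariance it
  -- holds from every `g n • s`; yet from `g n • s` near `ξ`, both `η` and `k • η` lie in the
  -- direction of `s`, so their product is large.
  obtain ⟨C, hC⟩ : ∃ C, ∀ a ∈ MulAction.orbit G η, ∀ b ∈ MulAction.orbit G η, a ≠ b →
      BoundaryProductLE s C a b := by
    have : ∀ p : GromovBoundary S × GromovBoundary S, ∃ C, p.1 ≠ p.2 →
        BoundaryProductLE s C p.1 p.2 := fun p => by
      by_cases h : p.1 = p.2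
      · exact ⟨0, fun h' => (h' h).elim⟩
      · exact (exists_boundaryProductLE s h).imp fun C hC _ => hC
    choose c hc using this
    obtain ⟨C, hC⟩ := ((hfin.prod hfin).image c).bddAbove
    exact ⟨C, fun a ha b hb hab => (hc (a, b) hab).mono (hC ⟨(a, b), ⟨ha, hb⟩, rfl⟩)⟩
  obtain ⟨x, hx⟩ := η.exists_converges
  obtain ⟨y, hy⟩ := (k • η).exists_converges
  obtain ⟨K, hK⟩ := exists_boundaryProductLE s hξη
  obtain ⟨K', hK'⟩ := exists_boundaryProductLE s hξη'
  obtain ⟨N, hN⟩ := hK _ _ hg hx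
  obtain ⟨N', hN'⟩ := hK' _ _ hg hy
  obtain ⟨n, hn, hnN⟩ := (((hg.1.tendsto_dist s).eventually_gt_atTop (C + δ + max K K')).and
    (eventually_ge_atTop (max N N'))).exists
  have hsep : BoundaryProductLE (g n • s) C (k • η) η := by
    have := (hC ((g n)⁻¹ • k • η) (by rw [smul_smul]; exact MulAction.mem_orbit _ _)
      ((g n)⁻¹ • η) (MulAction.mem_orbit _ _) (fun h => hk (smul_left_cancel _ h))).smul (g n)
    rwa [smul_inv_smul, smul_inv_smul] at this
  obtain ⟨N'', hN''⟩ := hsep _ _ hy hx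
  rw [max_le_iff] at hnN
  set i := max N (max N' N'')
  have hi : N ≤ i := le_max_left _ _
  have hi' : N' ≤ i := (le_max_left _ _).trans (le_max_right _ _)
  have hi'' : N'' ≤ i := (le_max_right _ _).trans (le_max_right _ _)
  have e₁ := hN n hnN.1 i hi
  have e₂ := hN' n hnN.2 i hi'
  have e₃ := hN'' i hi'' i hi''
  have f₁ := gromovProduct_add_gromovProduct s (g n • s) (x i)
  have f₂ := gromovProduct_add_gromovProduct s (g n • s) (y i)
  rw [gromovProduct_comm (g n • s) s (y i)] at f₂
  have := hδ.le_trans (a := dist (g n • s) s - max K K')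
    (show _ ≤ gromovProduct (g n • s) (y i) s by linarith [le_max_right K K'])
    (show _ ≤ gromovProduct (g n • s) s (x i) by linarith [le_max_left K K'])
  linarith

end BoundaryAction

/-! ### Invariant random subgroups -/

section IRS

variable {G : Type*} [Group G]

theorem measurableSet_setOf_mem (g : G) : MeasurableSet {H : Subgroup G | g ∈ H} := by
  classical
  have hc : Continuous fun (H : Subgroup G) (k : G) => decide (k ∈ H) := by
    convert continuous_induced_dom
  have : BorelSpace (Subgroup G) := ⟨rfl⟩
  have ho : IsOpen {H : Subgroup G | g ∈ H} := by
    convert (isOpen_discrete ({true} : Set Bool)).preimage ((continuous_apply g).comp hc) using 1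
    ext H
    simp
  exact ho.measurableSet

theorem measurableSet_setOf_exists_mem [Countable G] (Q : G → Prop) :
    MeasurableSet {H : Subgroup G | ∃ h ∈ H, Q h} := by
  have : {H : Subgroup G | ∃ h ∈ H, Q h} = ⋃ h : {h : G // Q h}, {H | (h : G) ∈ H} := by
    ext H
    simp [and_comm]
  rw [this]
  exact MeasurableSet.iUnion fun h => measurableSet_setOf_mem _

theorem measurableSet_setOf_forall_mem [Countable G] (Q : G → Prop) :
    MeasurableSet {H : Subgroup G | ∀ h ∈ H, Q h} := by
  convert (measurableSet_setOf_exists_mem fun h => ¬ Q h).compl using 1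
  ext H
  simp

theorem mem_conj_smul_iff {g h : G} {H : Subgroup G} :
    h ∈ MulAut.conj g • H ↔ g⁻¹ * h * g ∈ H := by
  rw [Subgroup.mem_pointwise_smul_iff_inv_smul_mem, ← map_inv, MulAut.smul_def, MulAut.conj_apply,
    inv_inv]

theorem conj_mem_conj_smul {g h : G} {H : Subgroup G} (hh : h ∈ H) :
    g * h * g⁻¹ ∈ MulAut.conj g • H := by
  rw [mem_conj_smul_iff]
  simpa [mul_assoc] using hh

/-! ### Recurrence under conjugation. -/

variable {μ : Measure (Subgroup G)}

/-- Recurrence: if the `n`-th conjugate of every element of `D R` lies in `A R n` for all large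
`n`, then the union of the `D R` is not larger than the set of subgroups that lie, for some `R`,
in infinitely many of the `A R n`. The sets `D R` need not be measurable. -/
theorem IsIRS.measure_iUnion_le (hμ : IsIRS μ) (g : ℕ → G) {D : ℕ → Set (Subgroup G)}
    (hD : Monotone D) {A : ℕ → ℕ → Set (Subgroup G)} (hA : ∀ R n, MeasurableSet (A R n))
    (hDA : ∀ R n, R ≤ n → ∀ H ∈ D R, MulAut.conj (g n) • H ∈ A R n) :
    μ (⋃ R, D R) ≤ μ {H | ∃ R, ∃ᶠ n in atTop, H ∈ A R n} := by
  have := hμ.isProbabilityMeasure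
  rw [hD.measure_iUnion]
  refine iSup_le fun R => ?_
  -- Reverse Fatou for the limsup of the `A R n`. Invariance is applied only to these measurable
  -- sets; `D R` enters through monotonicity alone.
  calc μ (D R) ≤ μ (⋂ N, ⋃ n ≥ N, A R n) := by
        rw [Antitone.measure_iInter]
        · refine le_iInf fun N => ?_
          have hn : max R N ≥ N := le_max_right _ _
          calc μ (D R) ≤ μ ((fun H => MulAut.conj (g (max R N)) • H) ⁻¹' A R (max R N)) :=
                measure_mono fun H hH => hDA R _ (le_max_left _ _) H hH
            _ = μ (A R (max R N)) := hμ.invariant _ _ (hA _ _)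
            _ ≤ μ (⋃ n ≥ N, A R n) := measure_mono (Set.subset_iUnion₂ (s := fun n _ => A R n) _ hn)
        · intro N N' h H hH
          obtain ⟨n, hn, hH⟩ := Set.mem_iUnion₂.1 hH
          exact Set.mem_iUnion₂.2 ⟨n, le_trans h hn, hH⟩
        · exact fun N => (MeasurableSet.iUnion fun n => MeasurableSet.iUnion fun _ =>
            hA R n).nullMeasurableSet
        · exact ⟨(0 : ℕ), measure_ne_top _ _⟩
    _ ≤ _ := by
        refine measure_mono fun H hH => ⟨R, frequently_atTop.2 fun N => ?_⟩
        simpa using Set.mem_iInter.1 hH N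

theorem IsIRS.ae_not_mem (hμ : IsIRS μ) (g : ℕ → G) {D : ℕ → Set (Subgroup G)}
    (hD : Monotone D) {A : ℕ → ℕ → Set (Subgroup G)} (hA : ∀ R n, MeasurableSet (A R n))
    (hDA : ∀ R n, R ≤ n → ∀ H ∈ D R, MulAut.conj (g n) • H ∈ A R n)
    (h : ∀ᵐ H ∂μ, ∀ R, ¬ ∃ᶠ n in atTop, H ∈ A R n) : ∀ᵐ H ∂μ, ∀ R, H ∉ D R := by
  have h0 : μ {H | ∃ R, ∃ᶠ n in atTop, H ∈ A R n} = 0 := by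
    simpa only [ae_iff, not_forall, not_not] using h
  have := hμ.measure_iUnion_le g hD hA hDA
  rw [h0, nonpos_iff_eq_zero, measure_eq_zero_iff_ae_notMem] at this
  simpa using this

theorem IsIRS.ae_frequently_mem (hμ : IsIRS μ) (g : ℕ → G) {D : ℕ → Set (Subgroup G)}
    (hD : Monotone D) {A : ℕ → ℕ → Set (Subgroup G)} (hA : ∀ R n, MeasurableSet (A R n))
    (hDA : ∀ R n, R ≤ n → ∀ H ∈ D R, MulAut.conj (g n) • H ∈ A R n)
    (h : ∀ᵐ H ∂μ, ∃ R, H ∈ D R) : ∀ᵐ H ∂μ, ∃ R, ∃ᶠ n in atTop, H ∈ A R n := by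
  have := hμ.isProbabilityMeasure
  have hm : MeasurableSet {H | ∃ R, ∃ᶠ n in atTop, H ∈ A R n} := by
    simp only [← mem_limsup_iff_frequently_mem, Set.ofPred_exists]
    exact MeasurableSet.iUnion fun R => MeasurableSet.measurableSet_limsup (hA R)
  have h1 : μ (⋃ R, D R) = 1 := by
    rw [← measure_univ (μ := μ)]
    refine measure_congr (eventuallyEq_univ.2 ?_)
    filter_upwards [h] with H hH using Set.mem_iUnion.2 hH
  refine (prob_compl_eq_zero_iff hm).2 (le_antisymm prob_le_one ?_)
  rw [← h1]
  exact hμ.measure_iUnion_le g hD hA hDA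

end IRS

/-! ### Invariant random subgroups of groups acting on hyperbolic spaces -/

section Hyperbolic

theorem IsElliptic.conj_smul {G S : Type*} [Group G] [MetricSpace S] [MulAction G S]
    [IsIsometricSMul G S] {H : Subgroup G} (hH : IsElliptic S H) (g : G) :
    IsElliptic S (MulAut.conj g • H) := by
  intro s
  obtain ⟨C, hC⟩ := (isElliptic_iff (g⁻¹ • s)).1 hH
  refine (isElliptic_iff s).2 ⟨C, fun h hh => ?_⟩ s
  have := hC _ (mem_conj_smul_iff.1 hh)
  rwa [mul_smul, mul_smul, smul_inv_smul, dist_smul] at this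

/-- An ergodic invariant random subgroup is almost surely elliptic or almost surely not. -/
theorem IsErgodicIRS.ae_isElliptic_or {G S : Type*} [Group G] [Countable G] [MetricSpace S]
    [MulAction G S] [IsIsometricSMul G S] {μ : Measure (Subgroup G)} (hμ : IsErgodicIRS μ) (s : S) :
    (∀ᵐ H ∂μ, IsElliptic S H) ∨ ∀ᵐ H ∂μ, ¬ IsElliptic S H := by
  have := hμ.isProbabilityMeasure
  have hm : MeasurableSet {H : Subgroup G | IsElliptic S H} := by
    have : {H : Subgroup G | IsElliptic S H} =
        ⋃ C : ℕ, {H | ∀ h ∈ H, dist (h • s) s ≤ C} := by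
      ext H
      simp only [Set.mem_iUnion, Set.mem_ofPred_eq, isElliptic_iff s]
      constructor
      · rintro ⟨C, hC⟩
        obtain ⟨n, hn⟩ := exists_nat_ge C
        exact ⟨n, fun h hh => (hC h hh).trans hn⟩
      · rintro ⟨n, hn⟩
        exact ⟨n, hn⟩
    rw [this]
    exact MeasurableSet.iUnion fun C => measurableSet_setOf_forall_mem _
  rcases hμ.ergodic _ hm fun g => Set.ext fun H =>
      ⟨fun h => by simpa using h.conj_smul g⁻¹, fun h => h.conj_smul g⟩ with h | h
  · exact Or.inr (measure_eq_zero_iff_ae_notMem.1 h)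
  · exact Or.inl ((prob_compl_eq_zero_iff hm).2 h)

variable {G S : Type*} [Group G] [MetricSpace S] [GromovHyperbolic S] [MulAction G S]
  [IsIsometricSMul G S]

/-- Points of the limit set are limits of sequences `g n • s` for which `(g n)⁻¹ • s` either
converges or is separated at infinity. -/
theorem exists_seq_of_mem_limitSet (s : S) {ξ : GromovBoundary S} {H : Subgroup G}
    (hξ : ξ ∈ limitSet S H) :
    ∃ g : ℕ → G, ConvergesToBoundary (fun n => g n • s) ξ ∧
      ((∃ η, ConvergesToBoundary (fun n => (g n)⁻¹ • s) η) ∨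
        ∃ C : ℝ, ∀ i j, i ≠ j → gromovProduct s ((g i)⁻¹ • s) ((g j)⁻¹ • s) ≤ C) := by
  obtain ⟨g, -, hg⟩ := (mem_limitSet_iff s).1 hξ
  rcases exists_subseq_converges_or_separated s (fun n => (g n)⁻¹ • s) with
    ⟨φ, hφ, h⟩ | ⟨C, φ, hφ, h⟩
  · exact ⟨g ∘ φ, hg.comp hφ.tendsto_atTop, Or.inl ⟨_, h, rfl⟩⟩
  · exact ⟨g ∘ φ, hg.comp hφ.tendsto_atTop, Or.inr ⟨C, h⟩⟩

/-- For convergent `y`, an element moving the limit works. For separated `y`, an element moving `s`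
far works, because it cannot coarsely fix three of the directions. -/
theorem exists_eventually_gromovProduct_smul_le {y : ℕ → S} {s : S} {H : Subgroup G}
    (hH : ¬ IsElliptic S H)
    (hy : (∃ η, ConvergesToBoundary y η ∧ ¬ ∀ h ∈ H, h • η = η) ∨
      ∃ C : ℝ, ∀ i j, i ≠ j → gromovProduct s (y i) (y j) ≤ C) :
    ∃ p ∈ H, ∃ C : ℝ, ∀ᶠ n in atTop, gromovProduct s (y n) (p • y n) ≤ C := by
  obtain ⟨δ, hδ0, hδ⟩ := exists_isHyperbolicWith S
  rcases hy with ⟨η, hη, hfix⟩ | ⟨C, hC⟩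
  · push Not at hfix
    obtain ⟨p, hp, hpη⟩ := hfix
    obtain ⟨C, hC⟩ := exists_boundaryProductLE s hpη.symm
    obtain ⟨N, hN⟩ := hC _ _ hη (hη.smul p)
    exact ⟨p, hp, C, eventually_atTop.2 ⟨N, fun n hn => hN n hn n hn⟩⟩
  · rw [isElliptic_iff s] at hH
    push Not at hH
    obtain ⟨p, hp, hps⟩ := hH (2 * (C + 3 * δ))
    refine ⟨p, hp, C + 2 * δ, ?_⟩
    by_contra hcon
    rw [not_eventually] at hcon
    simp only [not_le] at hcon
    obtain ⟨i, -, hi⟩ := frequently_atTop.1 hcon 0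
    obtain ⟨j, hij, hj⟩ := frequently_atTop.1 hcon (i + 1)
    obtain ⟨k, hjk, hk⟩ := frequently_atTop.1 hcon (j + 1)
    have := hδ.dist_smul_le_of_three hδ0 (hC i j (by omega)) (hC i k (by omega))
      (hC j k (by omega)) p hi hj hk
    linarith

/-- A boundary point can be close to at most one direction of a separated sequence. -/
theorem exists_eventually_boundary_gromovProduct_le {x y : ℕ → S} {s : S} {ζ : GromovBoundary S}
    (hx : ConvergesToBoundary x ζ)
    (hy : (∃ η, ConvergesToBoundary y η ∧ ζ ≠ η) ∨
      ∃ C : ℝ, ∀ i j, i ≠ j → gromovProduct s (y i) (y j) ≤ C) :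
    ∃ C : ℝ, ∀ᶠ n in atTop, ∀ᶠ k in atTop, gromovProduct s (x k) (y n) ≤ C := by
  obtain ⟨δ, hδ0, hδ⟩ := exists_isHyperbolicWith S
  rcases hy with ⟨η, hη, hne⟩ | ⟨C, hC⟩
  · obtain ⟨C, hC⟩ := exists_boundaryProductLE s hne
    obtain ⟨N, hN⟩ := hC _ _ hx hη
    exact ⟨C, eventually_atTop.2 ⟨N, fun n hn => eventually_atTop.2 ⟨N, fun k hk => hN k hk n hn⟩⟩⟩
  · refine ⟨C + 2 * δ, ?_⟩
    by_contra hcon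
    rw [not_eventually] at hcon
    -- The `x k` are eventually close to each other, so a large product with one of them is, up to
    -- `δ`, large with all later ones.
    have big : ∀ n, (¬ ∀ᶠ k in atTop, gromovProduct s (x k) (y n) ≤ C + 2 * δ) →
        ∀ᶠ k in atTop, C + δ < gromovProduct s (x k) (y n) := fun n hn => by
      obtain ⟨N, hN⟩ := (asymptoticSeq_iff s).1 hx.1 (C + 2 * δ + 1)
      rw [not_eventually] at hn
      obtain ⟨l, hl, hl'⟩ := frequently_atTop.1 hn N
      filter_upwards [eventually_ge_atTop N] with k hk
      rw [not_le] at hl'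
      by_contra! hle
      rcases hδ.le_or_le (x l) hle with h | h
      · linarith [hN k hk l hl]
      · linarith
    obtain ⟨i, -, hi⟩ := frequently_atTop.1 hcon 0
    obtain ⟨j, hij, hj⟩ := frequently_atTop.1 hcon (i + 1)
    obtain ⟨k, hk, hk'⟩ := ((big i hi).and (big j hj)).exists
    rcases hδ.le_or_le (x k) (hC i j (by omega)) with h | h
    · rw [gromovProduct_comm] at h
      linarith
    · linarith

/-! ### Almost sure properties of elliptic and non-elliptic random subgroups. -/

variable {μ : Measure (Subgroup G)}

/-- An almost surely elliptic invariant random subgroup is contained in the elliptic radical. -/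
theorem IsIRS.ae_le_ellipticRadical [Countable G] (hμ : IsIRS μ)
    (hell : ∀ᵐ H ∂μ, IsElliptic S H) : ∀ᵐ H ∂μ, H ≤ ellipticRadical G S := by
  have key : ∀ h : G, h ∉ ellipticRadical G S → ∀ᵐ H ∂μ, h ∉ H := by
    intro h hh
    rw [mem_ellipticRadical_iff] at hh
    push Not at hh
    obtain ⟨ξ, ⟨s, g, -, hg⟩, hne⟩ := hh
    have := hμ.ae_not_mem (fun n => (g n)⁻¹) (D := fun _ => {H | h ∈ H})
      (A := fun _ n => {H | (g n)⁻¹ * h * g n ∈ H}) (fun _ _ _ => le_rfl)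
      (fun _ n => measurableSet_setOf_mem _)
      (fun _ n _ H hH => by simpa using conj_mem_conj_smul (g := (g n)⁻¹) hH) ?_
    · filter_upwards [this] with H hH using hH 0
    -- Infinitely many conjugates `(g n)⁻¹ * h * g n` lie in the elliptic `H`, so `h` moves those `g
    -- n • s` boundedly.
    · filter_upwards [hell] with H hH _ hfreq
      obtain ⟨C, hC⟩ := (isElliptic_iff s).1 hH
      refine hne (hg.smul_eq_of_frequently_dist_le (C := C) h (hfreq.mono fun n hn => ?_))
      rw [dist_comm, ← dist_smul (g n)⁻¹, inv_smul_smul, smul_smul, smul_smul]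
      exact hC _ hn
  have := ae_all_iff.2 fun h : {h : G // h ∉ ellipticRadical G S} => key h.1 h.2
  filter_upwards [this] with H hH h hh
  by_contra hcon
  exact hH ⟨h, hcon⟩ hh

/-- A given boundary point is almost surely not fixed by a non-elliptic invariant random
subgroup. -/
theorem IsIRS.ae_not_fixes [Countable G] (hG : IsGeneralType G S) (hμ : IsIRS μ)
    (hell : ∀ᵐ H ∂μ, ¬ IsElliptic S H) (η : GromovBoundary S) :
    ∀ᵐ H ∂μ, ¬ ∀ h ∈ H, h • η = η := by
  obtain ⟨f, hf⟩ : ∃ f : ℕ → MulAction.orbit G η, Function.Injective f :=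
    have := (hG.infinite_orbit η).to_subtype
    ⟨_, (Infinite.natEmbedding _).injective⟩
  choose g hg using fun n => (f n).2
  have := hμ.ae_not_mem g (D := fun _ => {H | ∀ h ∈ H, h • η = η})
    (A := fun _ n => {H | ∀ h ∈ H, h • g n • η = g n • η}) (fun _ _ _ => le_rfl)
    (fun _ n => measurableSet_setOf_forall_mem _) (fun _ n _ H hH h hh => ?_) ?_
  · filter_upwards [this] with H hH using hH 0
  · have := hH _ (mem_conj_smul_iff.1 hh)
    rw [mul_smul, mul_smul, inv_smul_eq_iff] at this
    exact this
  · filter_upwards [hell] with H hH _ hfreq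
    have hinj : ∀ i j, i < j → g i • η ≠ g j • η := fun i j hij h =>
      hij.ne (hf (Subtype.ext ((hg i).symm.trans (h.trans (hg j)))))
    obtain ⟨i, -, hi⟩ := frequently_atTop.1 hfreq 0
    obtain ⟨j, hij, hj⟩ := frequently_atTop.1 hfreq (i + 1)
    obtain ⟨k, hjk, hk⟩ := frequently_atTop.1 hfreq (j + 1)
    exact hH (isElliptic_of_fixes_three (hinj i j (by omega)) (hinj i k (by omega))
      (hinj j k (by omega)) hi hj hk)

/-- A given limit point of `G` is almost surely a limit point of a non-elliptic invariant random
subgroup. -/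
theorem IsIRS.ae_mem_limitSet [Countable G] (hG : IsGeneralType G S) (hμ : IsIRS μ)
    (hell : ∀ᵐ H ∂μ, ¬ IsElliptic S H) {ξ : GromovBoundary S}
    (hξ : ξ ∈ limitSet S (⊤ : Subgroup G)) : ∀ᵐ H ∂μ, ξ ∈ limitSet S H := by
  have s : S := hξ.choose
  obtain ⟨g, hg, hy⟩ := exists_seq_of_mem_limitSet s hξ
  have hmove : ∀ᵐ H ∂μ, ∃ p ∈ H, ∃ C : ℝ, ∀ᶠ n in atTop,
      gromovProduct s ((g n)⁻¹ • s) (p • (g n)⁻¹ • s) ≤ C := by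
    rcases hy with ⟨η, hη⟩ | hC
    · filter_upwards [hell, hμ.ae_not_fixes hG hell η] with H hH hH' using
        exists_eventually_gromovProduct_smul_le hH (Or.inl ⟨η, hη, hH'⟩)
    · filter_upwards [hell] with H hH using
        exists_eventually_gromovProduct_smul_le hH (Or.inr hC)
  have := hμ.ae_frequently_mem g
    (D := fun R => {H | ∃ p ∈ H, ∀ n, R ≤ n →
      gromovProduct s ((g n)⁻¹ • s) (p • (g n)⁻¹ • s) ≤ R})
    (A := fun R n => {H | ∃ h ∈ H, dist (g n • s) s - R ≤ gromovProduct s (g n • s) (h • s)})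
    ?_ (fun R n => measurableSet_setOf_exists_mem _) ?_ ?_
  · filter_upwards [this] with H ⟨R, hR⟩
    obtain ⟨φ, hφ, hφ'⟩ := extraction_of_frequently_atTop hR
    choose h hh hle using hφ'
    have hgφ := hg.comp hφ.tendsto_atTop
    refine ⟨s, h, hh, hgφ.of_le s fun M => ?_⟩
    filter_upwards [(hgφ.1.tendsto_dist s).eventually_ge_atTop (M + R)] with n hn
    have := hle n
    simp only [Function.comp] at hn ⊢
    linarith
  · rintro R R' hRR' H ⟨p, hp, h⟩
    exact ⟨p, hp, fun n hn => (h n (hRR'.trans hn)).trans (by exact_mod_cast hRR')⟩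
  · rintro R n hRn H ⟨p, hp, h⟩
    refine ⟨g n * p * (g n)⁻¹, conj_mem_conj_smul hp, ?_⟩
    -- Seen from `g n • s`, the points `s` and its image have product at most `R`, by translating
    -- back with `(g n)⁻¹`; so seen from `s` the image lies in the direction of `g n • s`.
    have e := gromovProduct_add_gromovProduct s (g n • s) ((g n * p * (g n)⁻¹) • s)
    rw [gromovProduct_smul_base, smul_smul (g n)⁻¹ (g n * p * (g n)⁻¹) s,
      show (g n)⁻¹ * (g n * p * (g n)⁻¹) = p * (g n)⁻¹ by group, mul_smul p] at e
    linarith [h n hRn]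
  · filter_upwards [hmove] with H ⟨p, hp, C, hC⟩
    obtain ⟨N, hN⟩ := eventually_atTop.1 hC
    obtain ⟨R, hR⟩ := exists_nat_ge C
    refine ⟨max N R, p, hp, fun n hn => (hN n (le_trans (le_max_left _ _) hn)).trans
      (hR.trans ?_)⟩
    exact_mod_cast le_max_right N R

/-- The limit set of a non-elliptic invariant random subgroup is almost surely that of `G`. -/
theorem IsIRS.ae_limitSet_eq [Countable G] (hG : IsGeneralType G S) (hμ : IsIRS μ)
    (hell : ∀ᵐ H ∂μ, ¬ IsElliptic S H) :
    ∀ᵐ H ∂μ, limitSet S H = limitSet S (⊤ : Subgroup G) := by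
  obtain ⟨δ, -, hδ⟩ := exists_isHyperbolicWith S
  have s : S := hG.1.nonempty.choose_spec.choose
  -- `Λ(G)` may be uncountable, so the almost sure statements for single points cannot be
  -- intersected. One limit point is chosen for each of the countably many pairs `(g, k)`, and its
  -- presence in `Λ(H)` suffices to approximate all of `Λ(G)`.
  have key : ∀ (g : G) (k : ℕ), ∀ᵐ H ∂μ, (∃ x ξ, ξ ∈ limitSet S (⊤ : Subgroup G) ∧
      ConvergesToBoundary x ξ ∧ ∀ᶠ n in atTop, (k : ℝ) ≤ gromovProduct s (g • s) (x n)) →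
      ∃ h ∈ H, (k : ℝ) - δ ≤ gromovProduct s (g • s) (h • s) := by
    intro g k
    by_cases hex : ∃ x ξ, ξ ∈ limitSet S (⊤ : Subgroup G) ∧
      ConvergesToBoundary x ξ ∧ ∀ᶠ n in atTop, (k : ℝ) ≤ gromovProduct s (g • s) (x n)
    · obtain ⟨x, ξ, hξ, hx, hxg⟩ := hex
      filter_upwards [hμ.ae_mem_limitSet hG hell hξ] with H hH _
      obtain ⟨h, hh, hhξ⟩ := (mem_limitSet_iff s).1 hH
      obtain ⟨N, hN⟩ := (asymptoticSeq_iff s).1 (hx.asymptoticSeq hhξ) k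
      obtain ⟨n, hn, hn'⟩ := (hxg.and (eventually_ge_atTop N)).exists
      exact ⟨h n, hh n, hδ.le_trans hn (hN n hn' n hn')⟩
    · exact ae_of_all _ fun H h => (hex h).elim
  filter_upwards [ae_all_iff.2 fun g => ae_all_iff.2 (key g)] with H hH
  refine (limitSet_mono le_top).antisymm fun ξ hξ => ?_
  obtain ⟨g, -, hg⟩ := (mem_limitSet_iff s).1 hξ
  have hev : ∀ k : ℕ, ∃ᶠ m in atTop, ∃ h ∈ H, (k : ℝ) - δ ≤ gromovProduct s (g m • s) (h • s) :=
    fun k => by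
      obtain ⟨N, hN⟩ := (asymptoticSeq_iff s).1 hg.1 k
      refine Eventually.frequently (eventually_atTop.2 ⟨N, fun m hm => ?_⟩)
      exact hH (g m) k ⟨_, ξ, hξ, hg, eventually_atTop.2 ⟨N, fun n hn => hN m hm n hn⟩⟩
  obtain ⟨φ, hφ, hφ'⟩ := extraction_forall_of_frequently hev
  choose h hh hle using hφ'
  refine ⟨s, h, hh, (hg.comp hφ.tendsto_atTop).of_le s fun M => ?_⟩
  filter_upwards [tendsto_natCast_atTop_atTop.eventually_ge_atTop (M + δ)] with n hn
  have := hle n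
  simp only [Function.comp]
  linarith

/-- If `H` fixes the boundary point represented by `x`, which is seen from `g • s` in a direction
different from that of `s`, then `H` coarsely fixes the direction of `g • s` seen from `s`. -/
theorem IsHyperbolicWith.le_gromovProduct_of_fixes {δ : ℝ} (hδ0 : 0 ≤ δ)
    (hδ : IsHyperbolicWith S δ) {x : ℕ → S} {ζ : GromovBoundary S} (hx : ConvergesToBoundary x ζ)
    {s : S} {g h : G} {R : ℝ} (hR : ∀ᶠ k in atTop, gromovProduct (g • s) (x k) s ≤ R)
    (hh : h • ζ = ζ) :
    dist (g • s) s - R - dist (h • s) s - 2 * δ ≤ gromovProduct s (g • s) (h • g • s) := by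
  have hxh := hx.smul h
  rw [hh] at hxh
  obtain ⟨N, hN⟩ := (asymptoticSeq_iff s).1 (hx.asymptoticSeq hxh) (dist (g • s) s - R)
  obtain ⟨k, hk, hkN⟩ := (hR.and (eventually_ge_atTop N)).exists
  -- The chain is `g • s`, `x k`, `h • x k`, `h • g • s`: two four-point inequalities cost `2 * δ`,
  -- and moving the base point from `h • s` to `s` costs `dist (h • s) s`.
  have e₁ := gromovProduct_add_gromovProduct s (g • s) (x k)
  rw [gromovProduct_comm (g • s) s] at e₁
  have e₂ := hN k hkN k hkN
  have e₃ := gromovProduct_le_add_dist_base (h • s) s (h • x k) (h • g • s)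
  rw [gromovProduct_smul, gromovProduct_comm s (x k)] at e₃
  have d := dist_nonneg (x := h • s) (y := s)
  have e₄ := hδ.le_trans (a := dist (g • s) s - R - dist (h • s) s)
    (show _ ≤ gromovProduct s (g • s) (x k) by linarith) (e₂.trans' (by linarith))
  have e₅ := hδ.le_trans e₄ (show _ ≤ gromovProduct s (h • x k) (h • g • s) by linarith)
  linarith

/-- A non-elliptic invariant random subgroup almost surely fixes no boundary point. -/
theorem IsIRS.ae_fixesNoBoundaryPoint [Countable G] (hG : IsGeneralType G S) (hμ : IsIRS μ)
    (hell : ∀ᵐ H ∂μ, ¬ IsElliptic S H) : ∀ᵐ H ∂μ, FixesNoBoundaryPoint S H := by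
  obtain ⟨δ, hδ0, hδ⟩ := exists_isHyperbolicWith S
  obtain ⟨ξ, hξ⟩ := hG.1.nonempty
  have s : S := hξ.choose
  obtain ⟨g, hg, hy⟩ := exists_seq_of_mem_limitSet s hξ
  have hdir : ∀ᵐ H ∂μ, ∀ ζ x, ConvergesToBoundary x ζ → (∀ h ∈ H, h • ζ = ζ) →
      ∃ C : ℝ, ∀ᶠ n in atTop, ∀ᶠ k in atTop, gromovProduct s (x k) ((g n)⁻¹ • s) ≤ C := by
    rcases hy with ⟨η, hη⟩ | hC
    · filter_upwards [hμ.ae_not_fixes hG hell η] with H hH ζ x hx hζ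
      refine exists_eventually_boundary_gromovProduct_le hx (Or.inl ⟨η, hη, ?_⟩)
      rintro rfl
      exact hH hζ
    · exact ae_of_all _ fun H ζ x hx _ =>
        exists_eventually_boundary_gromovProduct_le hx (Or.inr hC)
  -- The fixed point `ζ` depends on `H` and ranges over a possibly uncountable set, so `D R` need
  -- not be measurable; `A R n` involves only countably many conditions on elements of `H`.
  have := hμ.ae_not_mem g
    (D := fun R => {H | ∃ ζ x, ConvergesToBoundary x ζ ∧ (∀ h ∈ H, h • ζ = ζ) ∧
      ∀ n, R ≤ n → ∀ᶠ k in atTop, gromovProduct s (x k) ((g n)⁻¹ • s) ≤ R})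
    (A := fun R n => {H | ∀ h ∈ H, dist (g n • s) s - R - dist (h • s) s - 2 * δ ≤
      gromovProduct s (g n • s) (h • g n • s)})
    ?_ (fun R n => measurableSet_setOf_forall_mem _) ?_ ?_
  · filter_upwards [this, hdir] with H hH hH'
    by_contra hcon
    unfold FixesNoBoundaryPoint at hcon
    push Not at hcon
    obtain ⟨ζ, hζ⟩ := hcon
    obtain ⟨x, hx⟩ := ζ.exists_converges
    obtain ⟨C, hC⟩ := hH' ζ x hx hζ
    obtain ⟨N, hN⟩ := eventually_atTop.1 hC
    obtain ⟨R, hR⟩ := exists_nat_ge C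
    refine hH (max N R) ⟨ζ, x, hx, hζ, fun n hn => ?_⟩
    filter_upwards [hN n (le_trans (le_max_left _ _) hn)] with k hk
    refine hk.trans (hR.trans ?_)
    exact_mod_cast le_max_right N R
  · rintro R R' hRR' H ⟨ζ, x, hx, hζ, h⟩
    refine ⟨ζ, x, hx, hζ, fun n hn => (h n (hRR'.trans hn)).mono fun k hk => hk.trans ?_⟩
    exact_mod_cast hRR'
  · rintro R n hRn H ⟨ζ, x, hx, hζ, hR⟩ h hh
    refine hδ.le_gromovProduct_of_fixes hδ0 (hx.smul (g n)) ?_ ?_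
    · simpa only [gromovProduct_smul_base, inv_smul_smul] using hR n hRn
    · have := hζ _ (mem_conj_smul_iff.1 hh)
      rw [mul_smul, mul_smul, inv_smul_eq_iff] at this
      exact this
  -- For fixed `h` the error terms do not depend on `n`, while `dist (g n • s) s → ∞`; so membership
  -- in infinitely many `A R n` makes `H` fix `ξ`.
  · filter_upwards [hμ.ae_not_fixes hG hell ξ] with H hH R hfreq
    refine hH fun h hh => (hg.eq_of_frequently (hg.smul h) s fun M => ?_).symm
    refine (hfreq.and_eventually ((hg.1.tendsto_dist s).eventually_ge_atTop
      (M + R + dist (h • s) s + 2 * δ))).mono fun n hn => ?_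
    linarith [hn.1 h hh, hn.2]

end Hyperbolic

theorem mainTheorem1 {G S : Type*} [Group G] [Countable G] [MetricSpace S] [GromovHyperbolic S]
    [MulAction G S] [IsIsometricSMul G S] (hG : IsGeneralType G S)
    (μ : Measure (Subgroup G)) (hμ : IsErgodicIRS μ) :
    IsGreatest {N : Subgroup G | N.Normal ∧ IsElliptic S N} (ellipticRadical G S) ∧
      ((∀ᵐ H ∂μ, IsGeometricallyDense S H) ∨ (∀ᵐ H ∂μ, H ≤ ellipticRadical G S)) := by
  refine ⟨isGreatest_ellipticRadical hG, ?_⟩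
  have s : S := hG.1.nonempty.choose_spec.choose
  rcases hμ.ae_isElliptic_or s with h | h
  · exact Or.inr (hμ.toIsIRS.ae_le_ellipticRadical h)
  · left
    filter_upwards [hμ.toIsIRS.ae_limitSet_eq hG h, hμ.toIsIRS.ae_fixesNoBoundaryPoint hG h]
      with H h₁ h₂ using ⟨h₁, h₂⟩
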